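/- **First-order side.** Let $\Sigma$ be a first-order signature (function symbols and predicate symbols of any finite arities). First-order formulas are built from atomic formulas $p(t_1,\dots,t_k)$, equalities $t_1=t_2$ and $\bot$ by the primitive connectives $\land,\lor,\to$ and quantifiers $\forall,\exists$. Let $\mathbf p=(p_1,\dots,p_m)$ be a tuple of distinct predicate symbols of $\Sigma$ and $\mathbf u=(u_1,\dots,u_m)$ a tuple of predicate variables with the same arities. Write $\mathbf u\le\mathbf p$ for $\bigwedge_i\forall\mathbf x(u_i(\mathbf x)\to p_i(\mathbf x))$, define $\mathbf p\le\mathbf u$ symmetrically, and write $\mathbf u<\mathbf p$ for $(\mathbf u\le\mathbf p)\land\neg(\mathbf p\le\mathbf u)$. For a formula $F$, the formula $F^*(\mathbf u)$ is defined recursively: $p_i(\mathbf t)^*=u_i(\mathbf t)$; $F^*=F$ for any other atomic formula (including equalities and $\bot$); $(F\odot G)^*=F^*\odot G^*$ for $\odot\in\{\land,\lor\}$; $(F\to G)^*=(F^*\to G^*)\land(F\to G)$; $(QxF)^*=QxF^*$ for $Q\in\{\forall,\exists\}$. An interpretation $I$ of $\Sigma$ is a *$\mathbf p$-stable model* of a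 sentence $F$ if $I$ satisfies $\mathrm{SM}_{\mathbf p}[F]:=F\land\neg\exists\mathbf u\,((\mathbf u<\mathbf p)\land F^*(\mathbf u))$. **Infinitary side.** Infinitary propositional formulas over a set $\sigma$ of atoms are built from atoms by conjunctions $\mathcal H^\land$ and disjunctions $\mathcal H^\lor$ of arbitrary sets $\mathcal H$ of formulas of bounded rank and by implications $F\to G$, every formula having a finite rank; $\top=\emptyset^\land$, $\bot=\emptyset^\lor$. Satisfaction by a set $X\subseteq\sigma$ is defined in the usual way. The reduct $F^X$ is defined recursively: for an atom $a$, $a^X$ is $a$ if $a\in X$ and $\bot$ otherwise; $(\mathcal H^\land)^X=\{G^X: G\in\mathcal H\}^\land$, and similarly for $\lor$; $(G\to H)^X$ is $G^X\to H^X$ if $X\models G\to H$ and $\bot$ otherwise. For $\mathcal A\subseteq\sigma$, write $Y\le_{\mathcal A}X$ if $Y\subseteq X$ and $X\setminus Y\subseteq\mathcal A$. The set $X$ is an *$\mathcal A$-stable model* of $F$ if $X$ is a minimal model of $F^X$ with respect to $\le_{\mathcal A}$. **Grounding.** Let $I$ be an interpretation of $\Sigma$ with non-empty domain $|I|$; give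 each $u\in|I|$ a name $u^*$, a new object constant interpreted by $I$ as $u$. Let $A_{\Sigma,I}$ be the set of atomic sentences $p(u_1^*,\dots,u_k^*)$ with $p$ a predicate symbol of $\Sigma$ and $u_1,\dots,u_k\in|I|$; let $I^r$ be the set of those elements of $A_{\Sigma,I}$ that are true in $I$, and $\mathbf p^I$ the set of those built with predicate symbols from $\mathbf p$. The *grounding* $\mathrm{gr}_I(F)$ of a sentence $F$ is the infinitary formula over $A_{\Sigma,I}$ defined recursively: $\mathrm{gr}_I(\bot)=\bot$; $\mathrm{gr}_I(p(t_1,\dots,t_k))=p((t_1^I)^*,\dots,(t_k^I)^*)$; $\mathrm{gr}_I(t_1=t_2)$ is $\top$ if $t_1^I=t_2^I$ and $\bot$ otherwise; $\mathrm{gr}_I(F\odot G)=\mathrm{gr}_I(F)\odot\mathrm{gr}_I(G)$ for $\odot\in\{\land,\lor,\to\}$; $\mathrm{gr}_I(\forall xF)=\{\mathrm{gr}_I(F^x_{u^*}): u\in|I|\}^\land$; $\mathrm{gr}_I(\exists xF)=\{\mathrm{gr}_I(F^x_{u^*}): u\in|I|\}^\lor$, where $F^x_{u^*}$ is the result of substituting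 $u^*$ for the free occurrences of $x$ in $F$. **Proposition.** For any first-order sentence $F$ over $\Sigma$, any tuple $\mathbf p$ of distinct predicate symbols of $\Sigma$ and any interpretation $I$ of $\Sigma$ with non-empty domain, $I$ is a $\mathbf p$-stable model of $F$ if and only if $I^r$ is a $\mathbf p^I$-stable model of $\mathrm{gr}_I(F)$. -/

import Mathlib

universe uF uR uM uA

namespace StableModels

open FirstOrder

/-! ### Infinitary propositional formulas -/

/-- Well-founded trees built from atoms by (possibly infinite) conjunctions and disjunctions and by
implication. A set `H` of trees is presented as the range of a family indexed by a type. -/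
inductive InfTree (σ : Type uA) : Type (uA + 1)
  | atom (a : σ) : InfTree σ
  | conj (ι : Type uA) (f : ι → InfTree σ) : InfTree σ
  | disj (ι : Type uA) (f : ι → InfTree σ) : InfTree σ
  | imp (F G : InfTree σ) : InfTree σ

namespace InfTree

variable {σ : Type uA}

/-- `⊤` is the empty conjunction. -/
def top : InfTree σ := conj PEmpty PEmpty.elim

/-- `⊥` is the empty disjunction. -/
def bot : InfTree σ := disj PEmpty PEmpty.elim

/-- `F ∧ G` is the conjunction of `{F, G}`. -/
def and (F G : InfTree σ) : InfTree σ := conj (ULift Bool) fun b => cond b.down F G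

/-- `F ∨ G` is the disjunction of `{F, G}`. -/
def or (F G : InfTree σ) : InfTree σ := disj (ULift Bool) fun b => cond b.down F G

/-- The rank: the least element of `ℕ ∪ {∞}` that is greater than the ranks of all immediate
constituents, and `∞` if these are unbounded. -/
noncomputable def rank : InfTree σ → ℕ∞
  | atom _ => 0
  | conj _ f => ⨆ i, (rank (f i) + 1)
  | disj _ f => ⨆ i, (rank (f i) + 1)
  | imp F G => max (rank F) (rank G) + 1

/-- Satisfaction of a tree by an interpretation, that is, a set of atoms. -/
def Sat (I : Set σ) : InfTree σ → Prop
  | atom a => a ∈ I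
  | conj _ f => ∀ i, Sat I (f i)
  | disj _ f => ∃ i, Sat I (f i)
  | imp F G => ¬ Sat I F ∨ Sat I G

open Classical in
/-- The reduct of a tree with respect to an interpretation. -/
noncomputable def reduct (I : Set σ) : InfTree σ → InfTree σ
  | atom a => if a ∈ I then atom a else bot
  | conj ι f => conj ι fun i => reduct I (f i)
  | disj ι f => disj ι fun i => reduct I (f i)
  | imp F G => if Sat I (imp F G) then imp (reduct I F) (reduct I G) else bot

theorem rank_top : rank (top : InfTree σ) = 0 := by
  simp [top, rank]

theorem rank_bot : rank (bot : InfTree σ) = 0 := by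
  simp [bot, rank]

theorem rank_reduct_le (I : Set σ) (F : InfTree σ) : rank (reduct I F) ≤ rank F := by
  induction F with
  | atom a => by_cases h : a ∈ I <;> simp [reduct, h, rank, rank_bot]
  | conj ι f ih => exact iSup_mono fun i => add_le_add_left (ih i) 1
  | disj ι f ih => exact iSup_mono fun i => add_le_add_left (ih i) 1
  | imp F G ihF ihG =>
    by_cases h : Sat I (imp F G)
    · simp only [reduct, h, if_true, rank]
      exact add_le_add_left (max_le_max ihF ihG) 1
    · simp [reduct, h, rank_bot]

end InfTree

/-- Infinitary propositional formulas over the signature `σ`: the trees of finite rank. -/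
structure InfFormula (σ : Type uA) where
  tree : InfTree σ
  rank_lt_top : tree.rank < ⊤

namespace InfFormula

variable {σ : Type uA}

/-- The satisfaction relation. -/
def Sat (I : Set σ) (F : InfFormula σ) : Prop := F.tree.Sat I

/-- The reduct of `F` with respect to `I`. -/
noncomputable def reduct (I : Set σ) (F : InfFormula σ) : InfFormula σ :=
  ⟨F.tree.reduct I, lt_of_le_of_lt (InfTree.rank_reduct_le I F.tree) F.rank_lt_top⟩

/-- The partial order `I ≤_A J`: `I ⊆ J` and `J \ I ⊆ A`. -/
def LEOn (A I J : Set σ) : Prop := I ⊆ J ∧ J \ I ⊆ A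

/-- `I` is an `A`-stable model of `F`: a minimal model of the reduct of `F` with respect to `I`, in
the sense of the partial order `≤_A`. -/
def IsStableModel (A : Set σ) (I : Set σ) (F : InfFormula σ) : Prop :=
  (F.reduct I).Sat I ∧ ∀ J : Set σ, (F.reduct I).Sat J → LEOn A J I → J = I

end InfFormula

/-! ### First-order formulas with all connectives primitive -/

/-- First-order formulas over the signature `L` with free variables among `x_0, …, x_(n-1)`. All of
`⊥, ∧, ∨, →, ∀, ∃` are primitive, since the classical definitions of some of them by others do
not preserve stable models. The quantifiers bind the variable with the last index. -/
inductive FOFormula (L : FirstOrder.Language.{uF, uR}) : ℕ → Type (max uF uR)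
  | falsum {n : ℕ} : FOFormula L n
  | rel {n k : ℕ} (R : L.Relations k) (ts : Fin k → L.Term (Fin n)) : FOFormula L n
  | equal {n : ℕ} (t s : L.Term (Fin n)) : FOFormula L n
  | and {n : ℕ} (F G : FOFormula L n) : FOFormula L n
  | or {n : ℕ} (F G : FOFormula L n) : FOFormula L n
  | imp {n : ℕ} (F G : FOFormula L n) : FOFormula L n
  | all {n : ℕ} (F : FOFormula L (n + 1)) : FOFormula L n
  | ex {n : ℕ} (F : FOFormula L (n + 1)) : FOFormula L n

/-- First-order sentences. -/
abbrev FOSentence (L : FirstOrder.Language.{uF, uR}) : Type (max uF uR) := FOFormula L 0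

namespace FOFormula

/-- Classical truth of a formula in a structure, under an assignment of the free variables. -/
def Realize {L : FirstOrder.Language.{uF, uR}} {M : Type uM} [L.Structure M] :
    {n : ℕ} → FOFormula L n → (Fin n → M) → Prop
  | _, falsum, _ => False
  | _, rel R ts, v => FirstOrder.Language.Structure.RelMap R fun i => (ts i).realize v
  | _, equal t s, v => t.realize v = s.realize v
  | _, and F G, v => F.Realize v ∧ G.Realize v
  | _, or F G, v => F.Realize v ∨ G.Realize v
  | _, imp F G, v => F.Realize v → G.Realize v
  | n, all F, v => ∀ u : M, F.Realize (Fin.snoc v u : Fin (n + 1) → M)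
  | n, ex F, v => ∃ u : M, F.Realize (Fin.snoc v u : Fin (n + 1) → M)

/-- A formula over `L`, read as a formula over a larger signature. -/
def onFormula {L : FirstOrder.Language.{uF, uR}} {L' : FirstOrder.Language.{uF, uR}} (φ : L →ᴸ L') :
    {n : ℕ} → FOFormula L n → FOFormula L' n
  | _, falsum => falsum
  | _, rel R ts => rel (φ.onRelation R) fun i => φ.onTerm (ts i)
  | _, equal t s => equal (φ.onTerm t) (φ.onTerm s)
  | _, and F G => and (F.onFormula φ) (G.onFormula φ)
  | _, or F G => or (F.onFormula φ) (G.onFormula φ)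
  | _, imp F G => imp (F.onFormula φ) (G.onFormula φ)
  | _, all F => all (F.onFormula φ)
  | _, ex F => ex (F.onFormula φ)

end FOFormula

/-! ### The operator SM -/

/-- A predicate symbol of `L`, together with its arity. -/
abbrev Pred (L : FirstOrder.Language.{uF, uR}) : Type uR := Σ k : ℕ, L.Relations k

section SM

variable {L : FirstOrder.Language.{uF, uR}} {m : ℕ}

/-- The predicate variables `u = (u_1, …, u_m)`, where `u_i` has the same arity as `p_i`. -/
def predVars (p : Fin m → Pred L) : FirstOrder.Language.{uF, uR} where
  Functions _ := PEmpty
  Relations k := ULift {i : Fin m // (p i).1 = k}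

/-- The signature `L` extended by the predicate variables `u`. -/
abbrev withPredVars (p : Fin m → Pred L) : FirstOrder.Language.{uF, uR} := L.sum (predVars p)

open Classical in
/-- The formula `F*(u)`. -/
noncomputable def star (p : Fin m → Pred L) : {n : ℕ} → FOFormula L n → FOFormula (withPredVars p) n
  | _, .falsum => .falsum
  | _, .rel (k := k) R ts =>
    if h : ∃ i, p i = ⟨k, R⟩ then
      .rel (Sum.inr ⟨h.choose, congrArg Sigma.fst h.choose_spec⟩)
        fun j => FirstOrder.Language.LHom.sumInl.onTerm (ts j)
    else (FOFormula.rel R ts).onFormula FirstOrder.Language.LHom.sumInl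
  | _, .equal t s => (FOFormula.equal t s).onFormula FirstOrder.Language.LHom.sumInl
  | _, .and F G => .and (star p F) (star p G)
  | _, .or F G => .or (star p F) (star p G)
  | _, .imp F G =>
    .and (.imp (star p F) (star p G)) ((FOFormula.imp F G).onFormula FirstOrder.Language.LHom.sumInl)
  | _, .all F => .all (star p F)
  | _, .ex F => .ex (star p F)

/-- A value for the tuple `u` of predicate variables over the universe `M`. -/
abbrev PredTuple (M : Type uM) (p : Fin m → Pred L) : Type uM :=
  (i : Fin m) → (Fin (p i).1 → M) → Prop

/-- The interpretation of the predicate variables that is given by a value of `u`. -/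
@[reducible] def predVarsStructure {M : Type uM} (p : Fin m → Pred L) (u : PredTuple M p) :
    (predVars p).Structure M where
  funMap f := f.elim
  RelMap i x := u i.down.1 fun j => x (Fin.cast i.down.2 j)

variable (M : Type uM) [L.Structure M]

/-- The extents in `M` of the predicates `p`. -/
def extents (p : Fin m → Pred L) : PredTuple M p :=
  fun i x => FirstOrder.Language.Structure.RelMap (p i).2 x

variable {M}

/-- `u ≤ w`: for every `i`, `∀ x (u_i(x) → w_i(x))`. -/
def PredLE {p : Fin m → Pred L} (u w : PredTuple M p) : Prop := ∀ i x, u i x → w i x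

/-- `u < w`: `(u ≤ w) ∧ ¬ (w ≤ u)`. -/
def PredLT {p : Fin m → Pred L} (u w : PredTuple M p) : Prop := PredLE u w ∧ ¬ PredLE w u

/-- `M` with the value `u` of the predicate variables satisfies `F*(u)`. -/
def SatStar (p : Fin m → Pred L) (u : PredTuple M p) (F : FOSentence L) : Prop :=
  letI : (predVars p).Structure M := predVarsStructure p u
  (star p F).Realize (Fin.elim0 : Fin 0 → M)

variable (M)

/-- `M` satisfies `SM_p[F]`, that is, `F ∧ ¬ ∃ u ((u < p) ∧ F*(u))`: `M` is a `p`-stable model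
of `F`. -/
def IsPStableModel (p : Fin m → Pred L) (F : FOSentence L) : Prop :=
  F.Realize (Fin.elim0 : Fin 0 → M) ∧
    ¬ ∃ u : PredTuple M p, PredLT u (extents M p) ∧ SatStar p u F

end SM

/-! ### Grounding -/

/-- The atomic sentences built with a predicate symbol of `L` and names of elements of `M`; the name
of an element is identified with the element. -/
structure GroundAtom (L : FirstOrder.Language.{uF, uR}) (M : Type uM) : Type (max uR uM) where
  arity : ℕ
  pred : L.Relations arity
  args : Fin arity → M

section Ground

variable {L : FirstOrder.Language.{uF, uR}} (M : Type uM)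

/-- The set of atomic sentences built with predicates from `p`. -/
def groundAtoms {m : ℕ} (p : Fin m → Pred L) : Set (GroundAtom L M) :=
  {a | ∃ i, p i = ⟨a.arity, a.pred⟩}

variable [L.Structure M]

/-- The set of atomic sentences that are true in the structure `M`. -/
def diagram : Set (GroundAtom L M) :=
  {a | FirstOrder.Language.Structure.RelMap a.pred a.args}

variable {M}

open Classical in
/-- The grounding of the sentence that is obtained from `F` when each free variable `x_i` is replaced
by the name of `v i`; so `Fin.snoc v u` substitutes the name of `u` for the variable of a
quantifier. -/
noncomputable def groundTree : {n : ℕ} → FOFormula L n → (Fin n → M) → InfTree (GroundAtom L M)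
  | _, .falsum, _ => .bot
  | _, .rel (k := k) R ts, v => .atom ⟨k, R, fun i => (ts i).realize v⟩
  | _, .equal t s, v => if t.realize v = s.realize v then .top else .bot
  | _, .and F G, v => .and (groundTree F v) (groundTree G v)
  | _, .or F G, v => .or (groundTree F v) (groundTree G v)
  | _, .imp F G, v => .imp (groundTree F v) (groundTree G v)
  | n, .all F, v =>
    .conj (ULift.{uR} M) fun u => groundTree F (Fin.snoc v u.down : Fin (n + 1) → M)
  | n, .ex F, v =>
    .disj (ULift.{uR} M) fun u => groundTree F (Fin.snoc v u.down : Fin (n + 1) → M)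

theorem exists_rank_groundTree_le {n : ℕ} (F : FOFormula L n) :
    ∃ r : ℕ, ∀ v : Fin n → M, (groundTree F v).rank ≤ r := by
  induction F with
  | falsum => exact ⟨0, fun v => by simp [groundTree, InfTree.rank_bot]⟩
  | rel R ts => exact ⟨0, fun v => by simp [groundTree, InfTree.rank]⟩
  | equal t s =>
    refine ⟨0, fun v => ?_⟩
    by_cases h : t.realize v = s.realize v <;>
      simp [groundTree, h, InfTree.rank_bot, InfTree.rank_top]
  | and F G ihF ihG | or F G ihF ihG =>
    obtain ⟨a, ha⟩ := ihF
    obtain ⟨b, hb⟩ := ihG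
    refine ⟨max a b + 1, fun v => iSup_le ?_⟩
    rintro ⟨_ | _⟩
    · exact add_le_add_left ((hb v).trans (Nat.cast_le.2 (le_max_right a b))) 1
    · exact add_le_add_left ((ha v).trans (Nat.cast_le.2 (le_max_left a b))) 1
  | imp F G ihF ihG =>
    obtain ⟨a, ha⟩ := ihF
    obtain ⟨b, hb⟩ := ihG
    refine ⟨max a b + 1, fun v => ?_⟩
    simp only [groundTree, InfTree.rank]
    exact add_le_add_left (max_le ((ha v).trans (Nat.cast_le.2 (le_max_left a b))) ((hb v).trans (Nat.cast_le.2 (le_max_right a b)))) 1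
  | all F ih | ex F ih =>
    obtain ⟨a, ha⟩ := ih
    exact ⟨a + 1, fun v => iSup_le fun u => add_le_add_left (ha _) 1⟩

variable (M)

/-- The grounding of the sentence `F` with respect to the structure `M`. -/
noncomputable def ground (F : FOSentence L) : InfFormula (GroundAtom L M) where
  tree := groundTree F (Fin.elim0 : Fin 0 → M)
  rank_lt_top := by
    obtain ⟨r, hr⟩ := exists_rank_groundTree_le (M := M) F
    exact lt_of_le_of_lt (hr _) (ENat.natCast_lt_top r)

end Ground

end StableModels

namespace StableModels

namespace FOFormula

/-! Values `u ≤ p` of the predicate variables correspond to sets `J` below `I^r` in the order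
restricted to `p^I`: `u` lists the extents of `p` in `J`, and outside `p` the set `J` agrees with
`I^r`. Strictness `u < p` means `J ≠ I^r`. Under this correspondence `F*(u)` holds iff `J` satisfies
the reduct of the grounding (`realize_star_iff`). The induction works because both transformations
treat an implication alike: they transform both sides and also require the original implication to
hold in `I`. So a counterexample `u` to `SM` is exactly a smaller model `J` of the reduct. The
remaining conjunct, truth of `F` itself, is handled by `sat_groundTree` and `sat_reduct_self`. -/

theorem realize_onFormula {L L' : FirstOrder.Language.{uF, uR}} {M : Type uM} [L.Structure M]
    [L'.Structure M] (φ : L →ᴸ L') [φ.IsExpansionOn M] {n : ℕ} (F : FOFormula L n)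
    (v : Fin n → M) : (F.onFormula φ).Realize v ↔ F.Realize v := by
  induction F with
  | falsum => exact Iff.rfl
  | rel R ts =>
    simp only [onFormula, Realize, FirstOrder.Language.LHom.realize_onTerm,
      FirstOrder.Language.LHom.map_onRelation]
  | equal t s => simp only [onFormula, Realize, FirstOrder.Language.LHom.realize_onTerm]
  | and F G ihF ihG => exact and_congr (ihF v) (ihG v)
  | or F G ihF ihG => exact or_congr (ihF v) (ihG v)
  | imp F G ihF ihG => exact imp_congr (ihF v) (ihG v)
  | all F ih => exact forall_congr' fun u => ih _
  | ex F ih => exact exists_congr fun u => ih _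

end FOFormula

/-! ### Satisfaction of infinitary formulas and of their reducts -/

namespace InfTree

variable {σ : Type uA} {I : Set σ}

theorem not_sat_bot : ¬ Sat I (bot : InfTree σ) := fun ⟨i, _⟩ => i.elim

theorem sat_top : Sat I (top : InfTree σ) := fun i => i.elim

theorem sat_and {F G : InfTree σ} : Sat I (and F G) ↔ Sat I F ∧ Sat I G :=
  ⟨fun h => ⟨h ⟨true⟩, h ⟨false⟩⟩, fun h => by rintro ⟨_ | _⟩; exacts [h.2, h.1]⟩

theorem sat_or {F G : InfTree σ} : Sat I (or F G) ↔ Sat I F ∨ Sat I G :=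
  ⟨by rintro ⟨⟨_ | _⟩, h⟩; exacts [.inr h, .inl h],
    fun h => h.elim (fun h => ⟨⟨true⟩, h⟩) (fun h => ⟨⟨false⟩, h⟩)⟩

theorem not_sat_reduct_bot {J : Set σ} : ¬ Sat J (reduct I (bot : InfTree σ)) :=
  fun ⟨i, _⟩ => i.elim

theorem sat_reduct_top {J : Set σ} : Sat J (reduct I (top : InfTree σ)) := fun i => i.elim

theorem sat_reduct_and {J : Set σ} {F G : InfTree σ} :
    Sat J (reduct I (and F G)) ↔ Sat J (reduct I F) ∧ Sat J (reduct I G) :=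
  ⟨fun h => ⟨h ⟨true⟩, h ⟨false⟩⟩, fun h => by rintro ⟨_ | _⟩; exacts [h.2, h.1]⟩

theorem sat_reduct_or {J : Set σ} {F G : InfTree σ} :
    Sat J (reduct I (or F G)) ↔ Sat J (reduct I F) ∨ Sat J (reduct I G) :=
  ⟨by rintro ⟨⟨_ | _⟩, h⟩; exacts [.inr h, .inl h],
    fun h => h.elim (fun h => ⟨⟨true⟩, h⟩) (fun h => ⟨⟨false⟩, h⟩)⟩

theorem sat_reduct_atom {J : Set σ} {a : σ} :
    Sat J (reduct I (atom a)) ↔ a ∈ I ∧ a ∈ J := by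
  by_cases h : a ∈ I
  · simp [reduct, h, Sat]
  · simp [reduct, h, not_sat_bot]

/-- Collapsing a false implication to `⊥` has the same effect as adding its truth in `I` as a
conjunct. This is the shape of the clause for `→` in `F*`. -/
theorem sat_reduct_imp {J : Set σ} {F G : InfTree σ} :
    Sat J (reduct I (imp F G)) ↔
      (Sat J (reduct I F) → Sat J (reduct I G)) ∧ (Sat I F → Sat I G) := by
  by_cases h : Sat I (imp F G)
  · rw [reduct, if_pos h, Sat, ← imp_iff_not_or, iff_self_and]
    exact fun _ => imp_iff_not_or.2 h
  · rw [reduct, if_neg h]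
    exact iff_of_false not_sat_bot fun h' => h (imp_iff_not_or.1 h'.2)

/-- An interpretation satisfies its own reduct of a tree iff it satisfies the tree. -/
theorem sat_reduct_self (F : InfTree σ) : Sat I (reduct I F) ↔ Sat I F := by
  induction F with
  | atom a => rw [sat_reduct_atom, and_self, Sat]
  | conj ι f ih => exact forall_congr' ih
  | disj ι f ih => exact exists_congr ih
  | imp F G ihF ihG => rw [sat_reduct_imp, ihF, ihG, and_self, Sat, imp_iff_not_or]

end InfTree

/-! ### Grounding, and the correspondence between `u` and `J` -/

section

variable {L : FirstOrder.Language.{uF, uR}} {M : Type uM} [L.Structure M]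

theorem sat_groundTree {n : ℕ} (F : FOFormula L n) (v : Fin n → M) :
    (groundTree F v).Sat (diagram M) ↔ F.Realize v := by
  induction F with
  | falsum => exact iff_of_false InfTree.not_sat_bot id
  | rel R ts => exact Iff.rfl
  | equal t s =>
    by_cases h : t.realize v = s.realize v
    · simp [groundTree, h, FOFormula.Realize, InfTree.sat_top]
    · simp [groundTree, h, FOFormula.Realize, InfTree.not_sat_bot]
  | and F G ihF ihG => exact InfTree.sat_and.trans (and_congr (ihF v) (ihG v))
  | or F G ihF ihG => exact InfTree.sat_or.trans (or_congr (ihF v) (ihG v))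
  | imp F G ihF ihG =>
    rw [groundTree, InfTree.Sat, ← imp_iff_not_or]
    exact imp_congr (ihF v) (ihG v)
  | all F ih => exact ULift.forall.trans (forall_congr' fun u => ih _)
  | ex F ih => exact ULift.exists.trans (exists_congr fun u => ih _)

variable {m : ℕ} {p : Fin m → Pred L}

/-- If `J ⊆ I^r` agrees with `I^r` outside `p` and with `u` on `p`, then `F*(u)` expresses that `J`
satisfies the reduct of the grounding of `F`. -/
theorem realize_star_iff {u : PredTuple M p} {J : Set (GroundAtom L M)}
    (hJ : InfFormula.LEOn (groundAtoms M p) J (diagram M))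
    (hu : ∀ i x, u i x ↔ (⟨(p i).1, (p i).2, x⟩ : GroundAtom L M) ∈ J)
    {n : ℕ} (F : FOFormula L n) (v : Fin n → M) :
    (letI : (predVars p).Structure M := predVarsStructure p u
     (star p F).Realize v) ↔ ((groundTree F v).reduct (diagram M)).Sat J := by
  let : (predVars p).Structure M := predVarsStructure p u
  change (star p F).Realize v ↔ _
  induction F with
  | falsum => exact iff_of_false id InfTree.not_sat_reduct_bot
  | @rel n k R ts =>
    rw [groundTree, InfTree.sat_reduct_atom, and_iff_right_of_imp fun h => hJ.1 h]
    by_cases h : ∃ i, p i = ⟨k, R⟩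
    · rw [star, dif_pos h]
      -- Stated for an arbitrary index, so that `p i` can be generalized and substituted away, which
      -- trivializes the cast. The index picked by `star` does not matter, since `hu` ties every
      -- index to `J`.
      have key : ∀ (i : Fin m) (hi : p i = ⟨k, R⟩) (x : Fin k → M),
          u i (fun j => x (Fin.cast (congrArg Sigma.fst hi) j)) ↔
            (⟨k, R, x⟩ : GroundAtom L M) ∈ J := by
        intro i hi x
        rw [hu]
        generalize p i = q at hi
        subst hi
        rfl
      refine Iff.trans ?_ (key h.choose h.choose_spec _)
      simp only [FOFormula.Realize, FirstOrder.Language.LHom.realize_onTerm]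
      exact Iff.rfl
    · rw [star, dif_neg h, FOFormula.realize_onFormula]
      -- A true atom missing from `J` would be built with a symbol of `p`.
      exact ⟨fun h' => by_contra fun hn => h (hJ.2 ⟨h', hn⟩), fun h' => hJ.1 h'⟩
  | equal t s =>
    rw [star, FOFormula.realize_onFormula]
    by_cases h : t.realize v = s.realize v
    · simp [groundTree, h, FOFormula.Realize, InfTree.sat_reduct_top]
    · simp [groundTree, h, FOFormula.Realize, InfTree.not_sat_reduct_bot]
  | and F G ihF ihG => exact (and_congr (ihF v) (ihG v)).trans InfTree.sat_reduct_and.symm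
  | or F G ihF ihG => exact (or_congr (ihF v) (ihG v)).trans InfTree.sat_reduct_or.symm
  | imp F G ihF ihG =>
    -- The conjunct about `I^r` becomes classical truth of `F → G`, matching the unstarred copy in
    -- `F*`.
    rw [groundTree, InfTree.sat_reduct_imp, sat_groundTree, sat_groundTree]
    exact and_congr (imp_congr (ihF v) (ihG v)) (FOFormula.realize_onFormula _ (F.imp G) v)
  | all F ih => exact ⟨fun h u => (ih _).1 (h u.down), fun h u => (ih _).2 (h ⟨u⟩)⟩
  | ex F ih => exact ⟨fun ⟨u, h⟩ => ⟨⟨u⟩, (ih _).1 h⟩, fun ⟨u, h⟩ => ⟨u.down, (ih _).2 h⟩⟩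

/-- The true ground atoms, except that the predicates `p` have the extents `u`. -/
def diagramWith (u : PredTuple M p) : Set (GroundAtom L M) :=
  {a | a ∈ diagram M ∧ ∀ i, ∀ h : p i = ⟨a.arity, a.pred⟩,
    u i fun j => a.args (Fin.cast (congrArg Sigma.fst h) j)}

/-- Injectivity of `p` prevents one symbol from receiving two different extents; `u ≤ p` ensures
that intersecting with the diagram loses no atom of `u`. -/
theorem mem_diagramWith_iff (hp : Function.Injective p) {u : PredTuple M p}
    (hu : PredLE u (extents M p)) (i : Fin m) (x : Fin (p i).1 → M) :
    u i x ↔ (⟨(p i).1, (p i).2, x⟩ : GroundAtom L M) ∈ diagramWith u := by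
  refine ⟨fun h => ⟨hu i x h, fun j hj => ?_⟩, fun h => h.2 i rfl⟩
  obtain rfl := hp hj
  exact h

theorem diagramWith_leOn (u : PredTuple M p) :
    InfFormula.LEOn (groundAtoms M p) (diagramWith u) (diagram M) := by
  refine ⟨fun a h => h.1, fun a h => by_contra fun hn => h.2 ⟨h.1, fun i hi => ?_⟩⟩
  exact (hn ⟨i, hi⟩).elim

end

end StableModels

theorem proposition2 {L : FirstOrder.Language.{uF, uR}}
    (F : StableModels.FOSentence L)
    {m : ℕ} (p : Fin m → StableModels.Pred L) (hp : Function.Injective p)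
    (M : Type uM) [Nonempty M] [L.Structure M] :
    StableModels.IsPStableModel M p F ↔
      (StableModels.ground M F).IsStableModel (StableModels.groundAtoms M p)
        (StableModels.diagram M) := by
  open StableModels in
  refine and_congr ((InfTree.sat_reduct_self _).trans (sat_groundTree F _)).symm ⟨?_, ?_⟩
  · intro h J hsat hJ
    -- An atom `a` of `I^r` missing from `J` makes the extents of `p` in `J` a value strictly below
    -- `p`, since `a` must be a `p`-atom.
    refine hJ.1.antisymm fun a ha => by_contra fun haJ => h ?_
    refine ⟨fun i x => (⟨(p i).1, (p i).2, x⟩ : GroundAtom L M) ∈ J,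
      ⟨fun i x hx => hJ.1 hx, fun hle => ?_⟩,
      (realize_star_iff hJ (fun _ _ => Iff.rfl) F _).2 hsat⟩
    obtain ⟨k, R, x⟩ := a
    obtain ⟨i, hi⟩ := hJ.2 ⟨ha, haJ⟩
    have hle' := hle i
    dsimp only [extents] at hle' hi
    generalize p i = q at hi hle'
    subst hi
    exact haJ (hle' x ha)
  · rintro h ⟨u, ⟨hle, hnle⟩, hsat⟩
    -- Minimality forces the set encoding `u` to be all of `I^r`, whence `p ≤ u`, contradicting `u <
    -- p`.
    have hJ := h (diagramWith u)
      ((realize_star_iff (diagramWith_leOn u) (mem_diagramWith_iff hp hle) F _).1 hsat)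
      (diagramWith_leOn u)
    refine hnle fun i x hx => (mem_diagramWith_iff hp hle i x).2 ?_
    rw [hJ]
    exact hx
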